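/- Let $P(M,G)$ be a smooth principal $G$-bundle (finite-dimensional manifolds), with right action $\kappa(p,g)=pg$, $\kappa_p:=\kappa(p,\cdot)$, $\kappa_g:=\kappa(\cdot,g)$, projection $\mu:P\to M$, and cotangent projection $\pi^*:T^*P\to P$. Let $Conn\,P(M,G)$ be the set of connection forms, i.e. smooth $T_eG$-valued one-forms $\alpha$ on $P$ with $\alpha_p\circ T\kappa_p(e)=\mathrm{id}$ and $\alpha_{pg}\circ T\kappa_g(p)=Ad_{g^{-1}}\circ\alpha_p$. Let $Can\,T^*P$ be the set of smooth one-forms $\gamma$ on $T^*P$ such that (i) $\gamma_\varphi\neq0$ for every nonzero $\varphi\in T^*P$, (ii) $\ker T\pi^*(\varphi)\subset\ker\gamma_\varphi$ for all $\varphi$, and (iii) $\langle\gamma,\xi\rangle$ is a smooth fibrewise linear function for every linear vector field $\xi$ on $T^*P$ (a smooth vector field on $T^*P$ which is a morphism of vector bundles from $T^*P\to P$ to $T(T^*P)\to TP$ over a smooth vector field $\chi$ on $P$). Let $Aut_0TP$ be the group of smooth vector bundle automorphisms $A$ of $TP$ covering $\mathrm{id}_P$; let $Aut_{TG}TP\subset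 Aut_0TP$ consist of those commuting with the maps $v_p\mapsto T\kappa_g(p)\,(v_p+T\kappa_p(e)X)$ for all $g\in G$, $X\in T_eG$; and let $Aut_NTP\subset Aut_{TG}TP$ consist of those $A=\mathrm{id}_{TP}+B$ for which $B(p)$ has values in $\ker T\mu(p)$ for every $p$. For $A\in Aut_0TP$ put $\Theta(A)_\varphi:=\varphi\circ A(\pi^*(\varphi))\circ T\pi^*(\varphi)$ and $A^*(\varphi):=\varphi\circ A(\pi^*(\varphi))$, and put $Can_{TG}T^*P:=\Theta(Aut_{TG}TP)$. Let $\gamma_0=\Theta(\mathrm{id}_{TP})$ be the canonical one-form and $\omega_0=d\gamma_0$. Fix a connection $\alpha\in Conn\,P(M,G)$. Then $$\iota_\alpha(\alpha')_\varphi:=\varphi\circ T\pi^*(\varphi)+\varphi\circ T\kappa_{\pi^*(\varphi)}(e)\circ(\alpha'_{\pi^*(\varphi)}-\alpha_{\pi^*(\varphi)})\circ T\pi^*(\varphi)$$ defines an embedding (injective map) of $Conn\,P(M,G)$ into $Can_{TG}T^*P$, and its values lie in $Can\,T^*P$. For every $\alpha'\in Conn\,P(M,G)$, with $B(p):=T\kappa_p(e)\circ(\alpha'_p-\alpha_p)$,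 one has $\mathrm{id}_{TP}+B\in Aut_NTP$, the bundle map $(\mathrm{id}_{TP}+B)^*:T^*P\to T^*P$ is smooth, the form $d\iota_\alpha(\alpha')$ is symplectic, and $d\iota_\alpha(\alpha')$ is the pullback of $\omega_0$ by $(\mathrm{id}_{TP}+B)^*$. -/

import Mathlib

open Bundle Set
open scoped Manifold ContDiff Bundle

noncomputable section

namespace GenCanon

/-! ### Differential forms on manifolds -/

section Forms

variable {E : Type*} [NormedAddCommGroup E] [NormedSpace ℝ E]
  {H : Type*} [TopologicalSpace H] (I : ModelWithCorners ℝ E H)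
  (N : Type*) [TopologicalSpace N] [ChartedSpace H N]

/-- A (not necessarily smooth) real differential form of degree `n` on `N`. -/
abbrev DiffForm (n : ℕ) : Type _ := (x : N) → TangentSpace I x [⋀^Fin n]→L[ℝ] ℝ

/-- A (not necessarily smooth) one-form on `N`: a covector at every point. -/
abbrev OneForm : Type _ := (x : N) → TangentSpace I x →L[ℝ] ℝ

/-- The total space of the cotangent bundle `T*N`. Its points are `φ = ⟨p, φ.2⟩` with
`p = φ.1 = π*(φ)` and `φ.2` a covector at `p`. -/
abbrev Cotangent : Type _ := TotalSpace (E →L[ℝ] ℝ) (fun x : N => TangentSpace I x →L[ℝ] ℝ)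

/-- The model with corners of the manifold `T*N`. -/
abbrev cotModel : ModelWithCorners ℝ (E × (E →L[ℝ] ℝ)) (ModelProd H (E →L[ℝ] ℝ)) :=
  I.prod 𝓘(ℝ, E →L[ℝ] ℝ)

variable {I N}

/-- A one-form regarded as a differential form of degree one. -/
def toForm (θ : OneForm I N) : DiffForm I N 1 := fun x =>
  ContinuousAlternatingMap.ofSubsingleton ℝ (TangentSpace I x) ℝ (0 : Fin 1) (θ x)

/-- The expression of a differential form in the chart at `x₀`: its pullback by the inverse of
the chart. -/
def inChart {n : ℕ} (σ : DiffForm I N n) (x₀ : N) : E → E [⋀^Fin n]→L[ℝ] ℝ := fun y =>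
  (σ ((extChartAt I x₀).symm y)).compContinuousLinearMap
    (mfderivWithin 𝓘(ℝ, E) I (extChartAt I x₀).symm (range I) y)

/-- A differential form is smooth if its expressions in all preferred charts are smooth. -/
def IsSmoothForm {n : ℕ} (σ : DiffForm I N n) : Prop :=
  ∀ x₀ : N, ContDiffOn ℝ ∞ (inChart σ x₀) (extChartAt I x₀).target

/-- The exterior derivative, computed at each point `x` in the chart at `x`. -/
def extD {n : ℕ} (σ : DiffForm I N n) : DiffForm I N (n + 1) := fun x =>
  (extDerivWithin (inChart σ x) (range I) (extChartAt I x x)).compContinuousLinearMap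
    (mfderiv I 𝓘(ℝ, E) (extChartAt I x) x)

/-- The pullback of a differential form by a map. -/
def pullback {E' : Type*} [NormedAddCommGroup E'] [NormedSpace ℝ E']
    {H' : Type*} [TopologicalSpace H'] {I' : ModelWithCorners ℝ E' H'}
    {N' : Type*} [TopologicalSpace N'] [ChartedSpace H' N']
    {n : ℕ} (σ : DiffForm I' N' n) (f : N → N') : DiffForm I N n := fun x =>
  (σ (f x)).compContinuousLinearMap (mfderiv I I' f x)

/-- A symplectic form: a smooth, closed, nondegenerate two-form. -/
structure IsSymplectic (σ : DiffForm I N 2) : Prop where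
  smooth : IsSmoothForm σ
  closed : extD σ = 0
  nondegenerate : ∀ (x : N) (v : TangentSpace I x),
    (∀ w : TangentSpace I x, σ x ![v, w] = 0) → v = 0

/-- A one-form is smooth if it is a smooth section of the cotangent bundle. -/
def IsSmoothOneForm [IsManifold I ∞ N] (θ : OneForm I N) : Prop :=
  ContMDiff I (cotModel I) ∞ (fun x => (⟨x, θ x⟩ : Cotangent I N))

end Forms

/-! ### The cotangent bundle and generalized canonical forms -/

section Canonical

variable {E : Type*} [NormedAddCommGroup E] [NormedSpace ℝ E]
  {P : Type*} [TopologicalSpace P] [ChartedSpace E P] [IsManifold 𝓘(ℝ, E) ∞ P]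

variable (E P) in
/-- The cotangent bundle `T*P`. -/
abbrev TStar : Type _ := Cotangent 𝓘(ℝ, E) P

variable (E) in
/-- The model with corners of `T*P`. -/
abbrev JJ : ModelWithCorners ℝ (E × (E →L[ℝ] ℝ)) (ModelProd E (E →L[ℝ] ℝ)) := cotModel 𝓘(ℝ, E)

/-- The tangent map `Tπ*(φ) : T_φ(T*P) → T_pP`, `p = π*(φ)`, of the projection `π* : T*P → P`. -/
def dproj (φ : TStar E P) : TangentSpace (JJ E) φ →L[ℝ] TangentSpace 𝓘(ℝ, E) φ.1 :=
  mfderiv (JJ E) 𝓘(ℝ, E) (fun ψ : TStar E P => ψ.1) φ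

variable (E P) in
/-- The canonical one-form `γ₀` on `T*P`. -/
def canonicalForm : OneForm (JJ E) (TStar E P) := fun φ => φ.2 ∘L dproj φ

variable (E P) in
/-- The Whitney sum `T*P ⊕ T*P` over `P`. -/
abbrev TStar₂ : Type _ :=
  TotalSpace ((E →L[ℝ] ℝ) × (E →L[ℝ] ℝ))
    ((fun p : P => TangentSpace 𝓘(ℝ, E) p →L[ℝ] ℝ) ×ᵇ
      (fun p : P => TangentSpace 𝓘(ℝ, E) p →L[ℝ] ℝ))

variable (E) in
/-- The model with corners of `T*P ⊕ T*P`. -/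
abbrev JJ₂ : ModelWithCorners ℝ (E × ((E →L[ℝ] ℝ) × (E →L[ℝ] ℝ)))
    (ModelProd E ((E →L[ℝ] ℝ) × (E →L[ℝ] ℝ))) :=
  𝓘(ℝ, E).prod 𝓘(ℝ, (E →L[ℝ] ℝ) × (E →L[ℝ] ℝ))

/-- The first projection `T*P ⊕ T*P → T*P`. -/
def whitneyFst (z : TStar₂ E P) : TStar E P := ⟨z.1, z.2.1⟩

/-- The second projection `T*P ⊕ T*P → T*P`. -/
def whitneySnd (z : TStar₂ E P) : TStar E P := ⟨z.1, z.2.2⟩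

/-- Fibrewise addition `T*P ⊕ T*P → T*P`. -/
def whitneyAdd (z : TStar₂ E P) : TStar E P := ⟨z.1, z.2.1 + z.2.2⟩

/-- Fibrewise multiplication by the real number `r`. -/
def fibreSMul (r : ℝ) (φ : TStar E P) : TStar E P := ⟨φ.1, r • φ.2⟩

/-- `(ξ, χ)` is a linear vector field on `T*P`: `ξ` and `χ` are smooth vector fields on `T*P` and
`P`, and `ξ : T*P → T(T*P)` is a morphism of vector bundles over `χ : P → TP`. Here the vector
bundle structure of `T(T*P) → TP` (with projection `Tπ*`) is the tangent prolongation of that of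
`T*P → P`: its addition and its scalar multiplications are the tangent maps of those of `T*P`. -/
structure IsLinearVectorField (ξ : (φ : TStar E P) → TangentSpace (JJ E) φ)
    (χ : (p : P) → TangentSpace 𝓘(ℝ, E) p) : Prop where
  smooth_total : ContMDiff (JJ E) (JJ E).tangent ∞
    (fun φ => (⟨φ, ξ φ⟩ : TangentBundle (JJ E) (TStar E P)))
  smooth_base : ContMDiff 𝓘(ℝ, E) 𝓘(ℝ, E).tangent ∞
    (fun p => (⟨p, χ p⟩ : TangentBundle 𝓘(ℝ, E) P))
  projects : ∀ φ, dproj φ (ξ φ) = χ φ.1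
  additive : ∀ (z : TStar₂ E P) (ζ : TangentSpace (JJ₂ E) z),
    mfderiv (JJ₂ E) (JJ E) whitneyFst z ζ = ξ (whitneyFst z) →
    mfderiv (JJ₂ E) (JJ E) whitneySnd z ζ = ξ (whitneySnd z) →
    mfderiv (JJ₂ E) (JJ E) whitneyAdd z ζ = ξ (whitneyAdd z)
  homogeneous : ∀ (r : ℝ) (φ : TStar E P),
    mfderiv (JJ E) (JJ E) (fibreSMul r) φ (ξ φ) = ξ (fibreSMul r φ)

/-- `l` is a smooth fibrewise linear function on `T*P`. -/
structure IsLinearFunction (l : TStar E P → ℝ) : Prop where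
  smooth : ContMDiff (JJ E) 𝓘(ℝ) ∞ l
  linear : ∀ p : P, IsLinearMap ℝ
    (fun η : TangentSpace 𝓘(ℝ, E) p →L[ℝ] ℝ => l (⟨p, η⟩ : TStar E P))

variable (E P) in
/-- The set `Can T*P` of generalized canonical forms on `T*P`: the smooth one-forms `γ` on `T*P`
such that `γ_φ ≠ 0` off the zero section, `ker Tπ*(φ) ⊆ ker γ_φ`, and `⟨γ, ξ⟩` is a smooth
fibrewise linear function for every linear vector field `ξ`. -/
def Can : Set (OneForm (JJ E) (TStar E P)) :=
  {γ | IsSmoothOneForm γ ∧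
    (∀ φ : TStar E P, φ.2 ≠ 0 → γ φ ≠ 0) ∧
    (∀ (φ : TStar E P) (v : TangentSpace (JJ E) φ), dproj φ v = 0 → γ φ v = 0) ∧
    (∀ ξ χ, IsLinearVectorField ξ χ → IsLinearFunction (fun φ : TStar E P => γ φ (ξ φ)))}

variable (E P) in
/-- A family of endomorphisms of the tangent spaces of `P`. -/
abbrev TangentEndo : Type _ :=
  (p : P) → TangentSpace 𝓘(ℝ, E) p →L[ℝ] TangentSpace 𝓘(ℝ, E) p

/-- `A ∈ Aut₀ TP`: `A` is a smooth automorphism of `TP` covering the identity of `P`. -/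
structure IsAut₀ (A : TangentEndo E P) : Prop where
  smooth : ContMDiff 𝓘(ℝ, E) (𝓘(ℝ, E).prod 𝓘(ℝ, E →L[ℝ] E)) ∞
    (fun p => (⟨p, A p⟩ : TotalSpace (E →L[ℝ] E)
      (fun p : P => TangentSpace 𝓘(ℝ, E) p →L[ℝ] TangentSpace 𝓘(ℝ, E) p)))
  bijective : ∀ p, Function.Bijective (A p)

/-- The one-form `Θ(A)` on `T*P`. -/
def Theta (A : TangentEndo E P) : OneForm (JJ E) (TStar E P) := fun φ =>
  φ.2 ∘L A φ.1 ∘L dproj φ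

/-- The dual bundle map `A* : T*P → T*P`, `A*(φ) = φ ∘ A(π*(φ))`. -/
def dual (A : TangentEndo E P) (φ : TStar E P) : TStar E P := ⟨φ.1, φ.2 ∘L A φ.1⟩

end Canonical

/-! ### Principal bundles and connections -/

section Principal

variable (EP EM EG : Type*) [NormedAddCommGroup EP] [NormedSpace ℝ EP]
  [NormedAddCommGroup EM] [NormedSpace ℝ EM] [NormedAddCommGroup EG] [NormedSpace ℝ EG]
  (P M G : Type*)
  [TopologicalSpace P] [ChartedSpace EP P] [IsManifold 𝓘(ℝ, EP) ∞ P]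
  [TopologicalSpace M] [ChartedSpace EM M] [IsManifold 𝓘(ℝ, EM) ∞ M]
  [TopologicalSpace G] [ChartedSpace EG G] [Group G] [LieGroup 𝓘(ℝ, EG) ∞ G]

/-- A smooth principal `G`-bundle `P(M, G)`: a smooth right action `κ` of `G` on `P` and a smooth
projection `μ : P → M` with smooth `G`-equivariant local trivializations `μ⁻¹(U) ≃ U × G`. -/
structure PrincipalBundle where
  /-- the right action `κ(p, g) = pg` -/
  κ : P → G → P
  /-- the bundle projection -/
  μ : P → M
  smooth_κ : ContMDiff (𝓘(ℝ, EP).prod 𝓘(ℝ, EG)) 𝓘(ℝ, EP) ∞ (fun z : P × G => κ z.1 z.2)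
  smooth_μ : ContMDiff 𝓘(ℝ, EP) 𝓘(ℝ, EM) ∞ μ
  act_one : ∀ p, κ p 1 = p
  act_mul : ∀ p g h, κ p (g * h) = κ (κ p g) h
  μ_act : ∀ p g, μ (κ p g) = μ p
  locally_trivial : ∀ m : M, ∃ (U : Set M) (e : OpenPartialHomeomorph P (M × G)),
    IsOpen U ∧ m ∈ U ∧ e.source = μ ⁻¹' U ∧ e.target = U ×ˢ univ ∧
    ContMDiffOn 𝓘(ℝ, EP) (𝓘(ℝ, EM).prod 𝓘(ℝ, EG)) ∞ e e.source ∧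
    ContMDiffOn (𝓘(ℝ, EM).prod 𝓘(ℝ, EG)) 𝓘(ℝ, EP) ∞ e.symm e.target ∧
    (∀ p ∈ e.source, (e p).1 = μ p) ∧
    (∀ p ∈ e.source, ∀ g, e (κ p g) = ((e p).1, (e p).2 * g))

variable {EP EM EG P M G}

namespace PrincipalBundle

variable (Q : PrincipalBundle EP EM EG P M G)

/-- The fundamental map `Tκ_p(e) : T_eG → T_pP`, where `κ_p(g) = pg`. The derivative has values in
the tangent space at `κ_p(e)`, and `κ_p(e) = p`. -/
def dorbit (p : P) : GroupLieAlgebra 𝓘(ℝ, EG) G →L[ℝ] TangentSpace 𝓘(ℝ, EP) p :=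
  (mfderiv 𝓘(ℝ, EG) 𝓘(ℝ, EP) (fun g : G => Q.κ p g) 1 : EG →L[ℝ] EP)

/-- The tangent map `Tκ_g(p) : T_pP → T_{pg}P`, where `κ_g(p) = pg`. -/
def dact (g : G) (p : P) : TangentSpace 𝓘(ℝ, EP) p →L[ℝ] TangentSpace 𝓘(ℝ, EP) (Q.κ p g) :=
  mfderiv 𝓘(ℝ, EP) 𝓘(ℝ, EP) (fun q : P => Q.κ q g) p

/-- The action `Φ_{(g, X)}(v) = Tκ_g(p)(v + Tκ_p(e) X)` of `TG ≅ G ⋉ T_eG` on `TP`. -/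
def Phi (g : G) (X : GroupLieAlgebra 𝓘(ℝ, EG) G) (p : P) (v : TangentSpace 𝓘(ℝ, EP) p) :
    TangentSpace 𝓘(ℝ, EP) (Q.κ p g) :=
  Q.dact g p (v + Q.dorbit p X)

/-- `A ∈ Aut_{TG} TP`: `A` is an element of `Aut₀ TP` that commutes with the action of `TG`. -/
structure IsAutTG (A : TangentEndo EP P) : Prop where
  isAut₀ : IsAut₀ A
  commutes : ∀ (g : G) (X : GroupLieAlgebra 𝓘(ℝ, EG) G) (p : P) (v : TangentSpace 𝓘(ℝ, EP) p),
    A (Q.κ p g) (Q.Phi g X p v) = Q.Phi g X p (A p v)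

/-- `A ∈ Aut_N TP`: `A` is an element of `Aut_{TG} TP` and `A(p) - id` has values in the vertical
space `ker Tμ(p)`. -/
structure IsAutN (A : TangentEndo EP P) : Prop where
  isAutTG : Q.IsAutTG A
  vertical : ∀ (p : P) (v : TangentSpace 𝓘(ℝ, EP) p),
    mfderiv 𝓘(ℝ, EP) 𝓘(ℝ, EM) Q.μ p (A p v - v) = 0

/-- The set `Can_{TG} T*P = Θ(Aut_{TG} TP)`. -/
def CanTG : Set (OneForm (JJ EP) (TStar EP P)) := {γ | ∃ A, Q.IsAutTG A ∧ γ = Theta A}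

end PrincipalBundle

/-- The adjoint representation `Ad_g : T_eG → T_eG`, the derivative of `h ↦ g h g⁻¹` at `e`
(which maps `e` to `e`). -/
def Ad (g : G) : GroupLieAlgebra 𝓘(ℝ, EG) G →L[ℝ] GroupLieAlgebra 𝓘(ℝ, EG) G :=
  (mfderiv 𝓘(ℝ, EG) 𝓘(ℝ, EG) (fun h : G => g * h * g⁻¹) 1 : EG →L[ℝ] EG)

/-- The space `Conn P(M, G)` of connection forms: smooth `T_eG`-valued one-forms `α` on `P` with
`α_p ∘ Tκ_p(e) = id` and `α_{pg} ∘ Tκ_g(p) = Ad_{g⁻¹} ∘ α_p`. -/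
structure Connection (Q : PrincipalBundle EP EM EG P M G) where
  /-- the value of the form at a point -/
  form : (p : P) → TangentSpace 𝓘(ℝ, EP) p →L[ℝ] GroupLieAlgebra 𝓘(ℝ, EG) G
  smooth : ContMDiff 𝓘(ℝ, EP) (𝓘(ℝ, EP).prod 𝓘(ℝ, EP →L[ℝ] EG)) ∞
    (fun p => (⟨p, form p⟩ : TotalSpace (EP →L[ℝ] EG)
      (fun p : P => TangentSpace 𝓘(ℝ, EP) p →L[ℝ] Trivial P EG p)))
  form_dorbit : ∀ (p : P) (X : GroupLieAlgebra 𝓘(ℝ, EG) G), form p (Q.dorbit p X) = X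
  form_dact : ∀ (p : P) (g : G) (v : TangentSpace 𝓘(ℝ, EP) p),
    form (Q.κ p g) (Q.dact g p v) = Ad g⁻¹ (form p v)

namespace Connection

variable {Q : PrincipalBundle EP EM EG P M G}

/-- The endomorphism `B(p) = Tκ_p(e) ∘ (α'_p - α_p)` of `T_pP`. -/
def B (α α' : Connection Q) : TangentEndo EP P := fun p =>
  Q.dorbit p ∘L (α'.form p - α.form p)

/-- The automorphism `id + B` of `TP`. -/
def idAddB (α α' : Connection Q) : TangentEndo EP P := fun p =>
  ContinuousLinearMap.id ℝ (TangentSpace 𝓘(ℝ, EP) p) + B α α' p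

/-- The one-form `ι_α(α')` on `T*P`, with value
`φ ∘ Tπ*(φ) + φ ∘ Tκ_p(e) ∘ (α'_p - α_p) ∘ Tπ*(φ)` at `φ`, where `p = π*(φ)`. -/
def iota (α α' : Connection Q) : OneForm (JJ EP) (TStar EP P) := fun φ =>
  φ.2 ∘L dproj φ + φ.2 ∘L Q.dorbit φ.1 ∘L (α'.form φ.1 - α.form φ.1) ∘L dproj φ

end Connection

end Principal

end GenCanon

end

/-
Every `A` in `Aut₀ TP` satisfies `π* ∘ A* = π*`, hence `Θ(A) = (A*)^* γ₀`, and
`ι_α(α') = Θ(id + B)`. Since `α_p ∘ Tκ_p(e) = id`, exchanging `α` and `α'` replaces `id + B` by its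
inverse. The dual `(id + B)*` is therefore a diffeomorphism of `T*P`, and `dι_α(α')` is the pullback
by it of `ω₀`, which is symplectic because in every chart of `T*P` coming from a chart of `P` the
form `γ₀` is `(q, η) ↦ η dq`. Injectivity holds because `Tπ*(φ)` is surjective and `α_p` is a left
inverse of `Tκ_p(e)`.
-/

noncomputable section

namespace GenCanon

open Filter
open scoped Topology

section Alternating

variable {𝕜 ι E F G X : Type*} [NontriviallyNormedField 𝕜] [Fintype ι]
  [NormedAddCommGroup E] [NormedSpace 𝕜 E] [NormedAddCommGroup F] [NormedSpace 𝕜 F]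
  [NormedAddCommGroup G] [NormedSpace 𝕜 G] [NormedAddCommGroup X] [NormedSpace 𝕜 X]

variable (𝕜 ι E G) in
/-- Antisymmetrization of continuous multilinear maps, without the factor `1 / n!`, as a continuous
linear map. -/
def alternatizationCLM [DecidableEq ι] :
    ContinuousMultilinearMap 𝕜 (fun _ : ι => E) G →L[𝕜] E [⋀^ι]→L[𝕜] G where
  toFun := ContinuousMultilinearMap.alternatization
  map_add' := map_add _
  map_smul' c f := by
    ext v
    simp [ContinuousMultilinearMap.alternatization_apply_apply, Finset.smul_sum, smul_comm c]
  cont := by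
    rw [ContinuousAlternatingMap.isEmbedding_toContinuousMultilinearMap.continuous_iff]
    change Continuous fun f : ContinuousMultilinearMap 𝕜 (fun _ : ι => E) G =>
      ∑ σ : Equiv.Perm ι, Equiv.Perm.sign σ • ContinuousMultilinearMap.domDomCongrₗᵢ 𝕜 E G σ f
    exact continuous_finsetSum _ fun σ _ =>
      (ContinuousMultilinearMap.domDomCongrₗᵢ 𝕜 E G σ).continuous.const_smul (Equiv.Perm.sign σ)

lemma alternatizationCLM_toContinuousMultilinearMap [DecidableEq ι] (f : E [⋀^ι]→L[𝕜] G) :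
    alternatizationCLM 𝕜 ι E G f.toContinuousMultilinearMap =
      ((Fintype.card ι).factorial : 𝕜) • f := by
  ext v
  have h := DFunLike.congr_fun (AlternatingMap.coe_alternatization f.toAlternatingMap) v
  simpa [alternatizationCLM, ContinuousMultilinearMap.alternatization_apply_apply,
    MultilinearMap.alternatization_apply, Function.comp_def, Nat.cast_smul_eq_nsmul] using h

-- Composition with linear maps is smooth on the larger space of multilinear maps, and
-- antisymmetrization is a continuous linear retraction of it onto the alternating ones, up to `n!`.
lemma contDiffAt_alternating_compContinuousLinearMap [CharZero 𝕜] {k : WithTop ℕ∞}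
    {f : X → F [⋀^ι]→L[𝕜] G} {g : X → E →L[𝕜] F} {x : X}
    (hf : ContDiffAt 𝕜 k f x) (hg : ContDiffAt 𝕜 k g x) :
    ContDiffAt 𝕜 k (fun y => (f y).compContinuousLinearMap (g y)) x := by
  classical
  have h_eq : (fun y => (f y).compContinuousLinearMap (g y)) = fun y =>
      ((Fintype.card ι).factorial : 𝕜)⁻¹ • alternatizationCLM 𝕜 ι E G
        (ContinuousMultilinearMap.compContinuousLinearMapContinuousMultilinear 𝕜
          (fun _ : ι => E) (fun _ : ι => F) G (fun _ => g y) (f y).toContinuousMultilinearMap) := by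
    funext y
    rw [eq_inv_smul_iff₀ (Nat.cast_ne_zero.2 (Nat.factorial_ne_zero _)),
      ← alternatizationCLM_toContinuousMultilinearMap]
    rfl
  rw [h_eq]
  refine ((alternatizationCLM 𝕜 ι E G).contDiff.contDiffAt.comp x (.clm_apply ?_ ?_)).const_smul _
  · exact (ContinuousMultilinearMap.contDiff _).contDiffAt.comp x (contDiffAt_pi.2 fun _ => hg)
  · exact (ContinuousAlternatingMap.toContinuousMultilinearMapCLM 𝕜).contDiff.contDiffAt.comp x hf

lemma contDiffAt_extDeriv {n : ℕ} {k r : WithTop ℕ∞} {β : E → E [⋀^Fin n]→L[𝕜] G} {x : E}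
    (hβ : ContDiffAt 𝕜 r β x) (hk : k + 1 ≤ r) : ContDiffAt 𝕜 k (extDeriv β) x := by
  have h_fderiv : ContDiffAt 𝕜 k (fderiv 𝕜 β) x := hβ.fderiv_right hk
  unfold extDeriv
  exact (ContinuousAlternatingMap.alternatizeUncurryFinCLM (n := n) 𝕜 E G).contDiff.contDiffAt.comp
    x h_fderiv

end Alternating

section Nondegenerate

variable {R M M' N : Type*} [Semiring R]
  [AddCommMonoid M] [Module R M] [TopologicalSpace M]
  [AddCommMonoid M'] [Module R M'] [TopologicalSpace M']
  [AddCommMonoid N] [Module R N] [TopologicalSpace N]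

/-- Nondegeneracy of an alternating two-form: only `0` pairs to zero with every vector. -/
def IsNondegenerate (β : M [⋀^Fin 2]→L[R] N) : Prop :=
  ∀ v, (∀ w, β ![v, w] = 0) → v = 0

lemma IsNondegenerate.compContinuousLinearMap {β : M' [⋀^Fin 2]→L[R] N} (hβ : IsNondegenerate β)
    {L : M →L[R] M'} (hL : Function.Bijective L) :
    IsNondegenerate (β.compContinuousLinearMap L) := fun v hv => by
  have hLv : L v = 0 := hβ (L v) fun u => by
    obtain ⟨w, rfl⟩ := hL.surjective u
    have h_vec : ![L v, L w] = L ∘ ![v, w] := funext (Fin.forall_fin_two.2 ⟨rfl, rfl⟩)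
    exact (congrArg β h_vec).trans (hv w)
  exact hL.injective (hLv.trans (map_zero L).symm)

end Nondegenerate

section Charts

variable {E : Type*} [NormedAddCommGroup E] [NormedSpace ℝ E]
  {H : Type*} [TopologicalSpace H] {I : ModelWithCorners ℝ E H} [I.Boundaryless]
  {N : Type*} [TopologicalSpace N] [ChartedSpace H N] {n : ℕ} {x₀ x : N} {y : E}

lemma inChart_eq (σ : DiffForm I N n) (x₀ : N) (y : E) :
    inChart σ x₀ y = (σ ((extChartAt I x₀).symm y)).compContinuousLinearMap
      (mfderiv 𝓘(ℝ, E) I (extChartAt I x₀).symm y) := by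
  have h := mfderivWithin_univ (I := 𝓘(ℝ, E)) (I' := I) (f := (extChartAt I x₀).symm)
  rw [← I.range_eq_univ] at h
  rw [inChart, h]
  rfl

lemma extD_eq (σ : DiffForm I N n) (x : N) :
    extD σ x = (extDeriv (inChart σ x) (extChartAt I x x)).compContinuousLinearMap
      (mfderiv I 𝓘(ℝ, E) (extChartAt I x) x) := by
  rw [extD, I.range_eq_univ, extDerivWithin_univ]

lemma IsSmoothForm.contDiffAt {σ : DiffForm I N n} (hσ : IsSmoothForm σ)
    (hy : y ∈ (extChartAt I x₀).target) : ContDiffAt ℝ ∞ (inChart σ x₀) y :=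
  (hσ x₀).contDiffAt (extChartAt_target_mem_nhds' hy)

variable [IsManifold I ∞ N]

lemma contMDiffAt_extChartAt_symm (hy : y ∈ (extChartAt I x₀).target) :
    ContMDiffAt 𝓘(ℝ, E) I ∞ (extChartAt I x₀).symm y :=
  (contMDiffOn_extChartAt_symm x₀).contMDiffAt (extChartAt_target_mem_nhds' hy)

lemma mfderiv_extChartAt_symm_mfderiv (hx : x ∈ (extChartAt I x₀).source) (v : E) :
    mfderiv 𝓘(ℝ, E) I (extChartAt I x₀).symm (extChartAt I x₀ x)
      (mfderiv I 𝓘(ℝ, E) (extChartAt I x₀) x v) = v := by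
  have : IsManifold I 1 N := .of_le (n := ∞) (by simp)
  have h := mfderivWithin_extChartAt_symm_comp_mfderiv_extChartAt' (I := I) hx
  rw [I.range_eq_univ, mfderivWithin_univ] at h
  exact DFunLike.congr_fun h v

lemma mfderiv_extChartAt_mfderiv_symm (hy : y ∈ (extChartAt I x₀).target) (v : E) :
    mfderiv I 𝓘(ℝ, E) (extChartAt I x₀) ((extChartAt I x₀).symm y)
      (mfderiv 𝓘(ℝ, E) I (extChartAt I x₀).symm y v) = v := by
  have : IsManifold I 1 N := .of_le (n := ∞) (by simp)
  have h := mfderiv_extChartAt_comp_mfderivWithin_extChartAt_symm (I := I) hy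
  rw [I.range_eq_univ, mfderivWithin_univ] at h
  exact DFunLike.congr_fun h v

end Charts

section LocalExpressions

variable {E : Type*} [NormedAddCommGroup E] [NormedSpace ℝ E]
  {H : Type*} [TopologicalSpace H] {I : ModelWithCorners ℝ E H}
  {N : Type*} [TopologicalSpace N] [ChartedSpace H N]
  {E' : Type*} [NormedAddCommGroup E'] [NormedSpace ℝ E']
  {H' : Type*} [TopologicalSpace H'] {I' : ModelWithCorners ℝ E' H'}
  {N' : Type*} [TopologicalSpace N'] [ChartedSpace H' N']
  {n : ℕ} {f : N → N'} {x₀ : N} {x₁ : N'} {x : N} {y : E}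

variable (I I') in
/-- The expression of a map in the charts at two given points. Unlike in `writtenInExtChartAt`, the
chart of the target is not tied to the value of the map at the centre of the first chart. -/
def chartRep (f : N → N') (x₀ : N) (x₁ : N') : E → E' :=
  fun y => extChartAt I' x₁ (f ((extChartAt I x₀).symm y))

variable [I.Boundaryless]

lemma eventually_mem_extChartAt (hf : Continuous f) (hy : y ∈ (extChartAt I x₀).target)
    (hfy : f ((extChartAt I x₀).symm y) ∈ (extChartAt I' x₁).source) :
    ∀ᶠ z in 𝓝 y, z ∈ (extChartAt I x₀).target ∧
      f ((extChartAt I x₀).symm z) ∈ (extChartAt I' x₁).source :=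
  .and (extChartAt_target_mem_nhds' hy) <|
    (hf.continuousAt.comp (continuousAt_extChartAt_symm'' hy)).eventually
      (extChartAt_source_mem_nhds' hfy)

variable [IsManifold I ∞ N] [IsManifold I' ∞ N']

lemma contDiffAt_chartRep (hf : ContMDiff I I' ∞ f) (hy : y ∈ (extChartAt I x₀).target)
    (hfy : f ((extChartAt I x₀).symm y) ∈ (extChartAt I' x₁).source) :
    ContDiffAt ℝ ∞ (chartRep I I' f x₀ x₁) y :=
  contMDiffAt_iff_contDiffAt.1 <|
    ContMDiffAt.comp y (contMDiffAt_extChartAt' (by rwa [extChartAt_source] at hfy))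
      (hf.contMDiffAt.comp y (contMDiffAt_extChartAt_symm hy))

lemma fderiv_chartRep (hf : ContMDiff I I' ∞ f) (hy : y ∈ (extChartAt I x₀).target)
    (hfy : f ((extChartAt I x₀).symm y) ∈ (extChartAt I' x₁).source) (v : E) :
    fderiv ℝ (chartRep I I' f x₀ x₁) y v =
      mfderiv I' 𝓘(ℝ, E') (extChartAt I' x₁) (f ((extChartAt I x₀).symm y))
        (mfderiv I I' f ((extChartAt I x₀).symm y)
          (mfderiv 𝓘(ℝ, E) I (extChartAt I x₀).symm y v)) := by
  have h_symm := (contMDiffAt_extChartAt_symm hy).mdifferentiableAt (by simp)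
  have h_map := hf.mdifferentiable (by simp) ((extChartAt I x₀).symm y)
  have h_chart := (contMDiffAt_extChartAt' (I := I') (n := ∞)
    (by rwa [extChartAt_source] at hfy)).mdifferentiableAt (by simp)
  rw [← mfderiv_eq_fderiv, show chartRep I I' f x₀ x₁ =
      extChartAt I' x₁ ∘ (f ∘ (extChartAt I x₀).symm) from rfl,
    mfderiv_comp (I' := I') y h_chart (h_map.comp y h_symm),
    mfderiv_comp (I' := I) y h_map h_symm]
  rfl

lemma fderiv_chartRep_mfderiv_extChartAt (hf : ContMDiff I I' ∞ f)
    (hx : x ∈ (extChartAt I x₀).source) (hfx : f x ∈ (extChartAt I' x₁).source)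
    (v : TangentSpace I x) :
    fderiv ℝ (chartRep I I' f x₀ x₁) (extChartAt I x₀ x)
      (mfderiv I 𝓘(ℝ, E) (extChartAt I x₀) x v) =
    mfderiv I' 𝓘(ℝ, E') (extChartAt I' x₁) (f x) (mfderiv I I' f x v) := by
  have h := fderiv_chartRep (x₁ := x₁) hf ((extChartAt I x₀).map_source hx)
    (by rwa [(extChartAt I x₀).left_inv hx]) (mfderiv I 𝓘(ℝ, E) (extChartAt I x₀) x v)
  rw [(extChartAt I x₀).left_inv hx] at h
  exact h.trans (congrArg (fun u : E => mfderiv I' 𝓘(ℝ, E') (extChartAt I' x₁) (f x)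
    (mfderiv I I' f x u)) (mfderiv_extChartAt_symm_mfderiv hx v))

variable [I'.Boundaryless]

lemma inChart_pullback (σ : DiffForm I' N' n) (hf : ContMDiff I I' ∞ f)
    (hy : y ∈ (extChartAt I x₀).target)
    (hfy : f ((extChartAt I x₀).symm y) ∈ (extChartAt I' x₁).source) :
    inChart (pullback (I := I) σ f) x₀ y =
      (inChart σ x₁ (chartRep I I' f x₀ x₁ y)).compContinuousLinearMap
        (fderiv ℝ (chartRep I I' f x₀ x₁) y) := by
  rw [inChart_eq, inChart_eq]
  ext v
  refine congrArg₂ (fun z (w : Fin n → E') => (show E' [⋀^Fin n]→L[ℝ] ℝ from σ z) w)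
    ((extChartAt I' x₁).left_inv hfy).symm (funext fun i => ?_)
  exact ((congrArg (mfderiv 𝓘(ℝ, E') I' (extChartAt I' x₁).symm (chartRep I I' f x₀ x₁ y))
    (fderiv_chartRep hf hy hfy (v i))).trans (mfderiv_extChartAt_symm_mfderiv hfy _)).symm

lemma inChart_pullback_eventuallyEq (σ : DiffForm I' N' n) (hf : ContMDiff I I' ∞ f)
    (hy : y ∈ (extChartAt I x₀).target)
    (hfy : f ((extChartAt I x₀).symm y) ∈ (extChartAt I' x₁).source) :
    inChart (pullback (I := I) σ f) x₀ =ᶠ[𝓝 y] fun z =>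
      (inChart σ x₁ (chartRep I I' f x₀ x₁ z)).compContinuousLinearMap
        (fderiv ℝ (chartRep I I' f x₀ x₁) z) :=
  (eventually_mem_extChartAt hf.continuous hy hfy).mono
    fun _ hz => inChart_pullback σ hf hz.1 hz.2

lemma IsSmoothForm.pullback {σ : DiffForm I' N' n} (hσ : IsSmoothForm σ)
    (hf : ContMDiff I I' ∞ f) : IsSmoothForm (pullback (I := I) σ f) := by
  intro x₀ y hy
  have hfy := mem_extChartAt_source (I := I') (f ((extChartAt I x₀).symm y))
  have h_rep := contDiffAt_chartRep hf hy hfy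
  have h_inChart := (hσ.contDiffAt ((extChartAt I' _).map_source hfy)).comp y h_rep
  exact ((contDiffAt_alternating_compContinuousLinearMap h_inChart
    (h_rep.fderiv_right (m := ∞) (by simp))).congr_of_eventuallyEq
      (inChart_pullback_eventuallyEq σ hf hy hfy)).contDiffWithinAt

end LocalExpressions

section ExteriorDerivative

variable {E : Type*} [NormedAddCommGroup E] [NormedSpace ℝ E]
  {H : Type*} [TopologicalSpace H] {I : ModelWithCorners ℝ E H}
  {N : Type*} [TopologicalSpace N] [ChartedSpace H N]
  {E' : Type*} [NormedAddCommGroup E'] [NormedSpace ℝ E']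
  {H' : Type*} [TopologicalSpace H'] {I' : ModelWithCorners ℝ E' H'}
  {N' : Type*} [TopologicalSpace N'] [ChartedSpace H' N']
  {n : ℕ} {f : N → N'} {x₀ : N} {x₁ : N'} {x : N} {y : E}

lemma minSmoothness_two_le_infty {𝕜 : Type*} [NontriviallyNormedField 𝕜]
    [IsRCLikeNormedField 𝕜] : minSmoothness 𝕜 2 ≤ ∞ := by
  rw [minSmoothness_of_isRCLikeNormedField]
  exact WithTop.coe_le_coe.2 le_top

lemma pullback_id (σ : DiffForm I N n) : pullback (I := I) σ id = σ := by
  funext x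
  rw [pullback, mfderiv_id]
  rfl

variable [I.Boundaryless] [IsManifold I ∞ N] [I'.Boundaryless] [IsManifold I' ∞ N']

lemma extDeriv_inChart_pullback {σ : DiffForm I' N' n} (hσ : IsSmoothForm σ)
    (hf : ContMDiff I I' ∞ f) (hy : y ∈ (extChartAt I x₀).target)
    (hfy : f ((extChartAt I x₀).symm y) ∈ (extChartAt I' x₁).source) :
    extDeriv (inChart (pullback (I := I) σ f) x₀) y =
      (extDeriv (inChart σ x₁) (chartRep I I' f x₀ x₁ y)).compContinuousLinearMap
        (fderiv ℝ (chartRep I I' f x₀ x₁) y) := by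
  rw [(inChart_pullback_eventuallyEq σ hf hy hfy).extDeriv_eq]
  exact extDeriv_pullback (r := ∞)
    ((hσ.contDiffAt ((extChartAt I' _).map_source hfy)).differentiableAt (by simp))
    (contDiffAt_chartRep hf hy hfy) minSmoothness_two_le_infty

lemma extD_pullback_apply {σ : DiffForm I' N' n} (hσ : IsSmoothForm σ)
    (hf : ContMDiff I I' ∞ f) (hfx : f x ∈ (extChartAt I' x₁).source)
    (v : Fin (n + 1) → TangentSpace I x) :
    extD (pullback (I := I) σ f) x v =
      extDeriv (inChart σ x₁) (extChartAt I' x₁ (f x)) fun i =>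
        mfderiv I' 𝓘(ℝ, E') (extChartAt I' x₁) (f x) (mfderiv I I' f x (v i)) := by
  rw [extD_eq, extDeriv_inChart_pullback (x₁ := x₁) hσ hf (mem_extChartAt_target x)
    (by rwa [extChartAt_to_inv])]
  exact congrArg₂ (fun z (w : Fin (n + 1) → E') => extDeriv (inChart σ x₁) z w)
    (by rw [chartRep, extChartAt_to_inv])
    (funext fun i => fderiv_chartRep_mfderiv_extChartAt hf (mem_extChartAt_source x) hfx (v i))

-- Independence of the chart is the naturality of the exterior derivative under the identity map.
lemma extD_apply {σ : DiffForm I N n} (hσ : IsSmoothForm σ)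
    (hx : x ∈ (extChartAt I x₀).source) (v : Fin (n + 1) → TangentSpace I x) :
    extD σ x v = extDeriv (inChart σ x₀) (extChartAt I x₀ x) fun i =>
      mfderiv I 𝓘(ℝ, E) (extChartAt I x₀) x (v i) := by
  have h := extD_pullback_apply hσ contMDiff_id hx v
  rwa [pullback_id, mfderiv_id] at h

lemma extD_pullback {σ : DiffForm I' N' n} (hσ : IsSmoothForm σ) (hf : ContMDiff I I' ∞ f) :
    extD (pullback (I := I) σ f) = pullback (extD σ) f := by
  funext x
  ext v
  have hfx := mem_extChartAt_source (I := I') (f x)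
  exact (extD_pullback_apply hσ hf hfx v).trans (extD_apply hσ hfx _).symm

lemma inChart_extD {σ : DiffForm I N n} (hσ : IsSmoothForm σ)
    (hy : y ∈ (extChartAt I x₀).target) :
    inChart (extD σ) x₀ y = extDeriv (inChart σ x₀) y := by
  ext v
  rw [inChart_eq]
  refine (extD_apply hσ ((extChartAt I x₀).map_target hy) _).trans ?_
  exact congrArg₂ (fun z (w : Fin (n + 1) → E) => extDeriv (inChart σ x₀) z w)
    ((extChartAt I x₀).right_inv hy) (funext fun i => mfderiv_extChartAt_mfderiv_symm hy (v i))

lemma inChart_extD_eventuallyEq {σ : DiffForm I N n} (hσ : IsSmoothForm σ)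
    (hy : y ∈ (extChartAt I x₀).target) :
    inChart (extD σ) x₀ =ᶠ[𝓝 y] extDeriv (inChart σ x₀) :=
  mem_of_superset (extChartAt_target_mem_nhds' hy) fun _ hz => inChart_extD hσ hz

lemma IsSmoothForm.extD {σ : DiffForm I N n} (hσ : IsSmoothForm σ) : IsSmoothForm (extD σ) := by
  intro x₀ y hy
  exact ((contDiffAt_extDeriv (k := ∞) (hσ.contDiffAt hy) (by simp)).congr_of_eventuallyEq
    (inChart_extD_eventuallyEq hσ hy)).contDiffWithinAt

lemma extD_extD {σ : DiffForm I N n} (hσ : IsSmoothForm σ) : extD (extD σ) = 0 := by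
  funext x
  have hx := mem_extChartAt_target (I := I) x
  rw [extD_eq, (inChart_extD_eventuallyEq hσ hx).extDeriv_eq,
    extDeriv_extDeriv_apply (r := ∞) (hσ.contDiffAt hx) minSmoothness_two_le_infty]
  rfl

lemma IsSymplectic.pullback_diffeomorph {σ : DiffForm I' N' 2} (hσ : IsSymplectic σ)
    (f : N ≃ₘ^∞⟮I, I'⟯ N') : IsSymplectic (pullback (I := I) σ f) where
  smooth := hσ.smooth.pullback f.contMDiff
  closed := by
    rw [extD_pullback hσ.smooth f.contMDiff, hσ.closed]
    rfl
  nondegenerate x := by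
    have h_bijective : Function.Bijective (mfderiv I I' f x) :=
      (f.mfderivToContinuousLinearEquiv (by simp) x).bijective
    exact IsNondegenerate.compContinuousLinearMap (hσ.nondegenerate (f x)) h_bijective

end ExteriorDerivative

section CanonicalForm

variable {E : Type*} [NormedAddCommGroup E] [NormedSpace ℝ E]

variable (E) in
/-- The canonical one-form `(q, η) ↦ η dq` of the model space, as a linear map. -/
def modelCanonicalForm : (E × (E →L[ℝ] ℝ)) →L[ℝ] (E × (E →L[ℝ] ℝ)) [⋀^Fin 1]→L[ℝ] ℝ :=
  (ContinuousAlternatingMap.ofSubsingletonLIE (𝕜 := ℝ) (E := E × (E →L[ℝ] ℝ)) (F := ℝ)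
      (0 : Fin 1)).toContinuousLinearEquiv.toContinuousLinearMap ∘L
    (ContinuousLinearMap.precomp ℝ (ContinuousLinearMap.fst ℝ E (E →L[ℝ] ℝ))) ∘L
    ContinuousLinearMap.snd ℝ E (E →L[ℝ] ℝ)

lemma modelCanonicalForm_apply (y : E × (E →L[ℝ] ℝ)) (v : Fin 1 → E × (E →L[ℝ] ℝ)) :
    modelCanonicalForm E y v = y.2 (v 0).1 := rfl

lemma extDeriv_modelCanonicalForm (y v w : E × (E →L[ℝ] ℝ)) :
    extDeriv (modelCanonicalForm E) y ![v, w] = v.2 w.1 - w.2 v.1 := by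
  rw [extDeriv, ContinuousLinearMap.fderiv,
    ContinuousAlternatingMap.alternatizeUncurryFin_apply, Fin.sum_univ_two]
  simp [modelCanonicalForm_apply, Fin.removeNth, sub_eq_add_neg]

lemma isNondegenerate_extDeriv_modelCanonicalForm (y : E × (E →L[ℝ] ℝ)) :
    IsNondegenerate (extDeriv (modelCanonicalForm E) y) := fun v hv => by
  simp only [extDeriv_modelCanonicalForm] at hv
  have h_fst : v.1 = 0 := SeparatingDual.eq_zero_of_forall_dual_eq_zero (R := ℝ) fun η => by
    simpa using hv (0, η)
  have h_snd : v.2 = 0 := ContinuousLinearMap.ext fun u => by simpa using hv (u, 0)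
  exact Prod.ext h_fst h_snd

variable {P : Type*} [TopologicalSpace P] [ChartedSpace E P] [IsManifold 𝓘(ℝ, E) ∞ P]
  {φ₀ ψ : TStar E P} {y : E × (E →L[ℝ] ℝ)}

lemma contMDiff_cotangent_proj :
    ContMDiff (JJ E) 𝓘(ℝ, E) ∞ (fun ψ : TStar E P => ψ.1) :=
  contMDiff_proj _

lemma extChartAt_cotangent_fst (φ₀ ψ : TStar E P) :
    (extChartAt (JJ E) φ₀ ψ).1 = extChartAt 𝓘(ℝ, E) φ₀.1 ψ.1 := by
  rw [FiberBundle.extChartAt]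
  rfl

lemma mem_extChartAt_cotangent_source :
    ψ ∈ (extChartAt (JJ E) φ₀).source ↔ ψ.1 ∈ (extChartAt 𝓘(ℝ, E) φ₀.1).source := by
  rw [FiberBundle.extChartAt, extChartAt_source]
  simp [hom_trivializationAt_apply]

lemma extChartAt_cotangent_snd_apply (h : ψ ∈ (extChartAt (JJ E) φ₀).source) (v : E) :
    (extChartAt (JJ E) φ₀ ψ).2 v =
      ψ.2 (mfderiv 𝓘(ℝ, E) 𝓘(ℝ, E) (extChartAt 𝓘(ℝ, E) φ₀.1).symm
        (extChartAt 𝓘(ℝ, E) φ₀.1 ψ.1) v) := by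
  have : IsManifold 𝓘(ℝ, E) 1 P := .of_le (n := ∞) (by simp)
  have h_base : ψ.1 ∈ (chartAt E φ₀.1).source := by
    simpa only [extChartAt_source] using mem_extChartAt_cotangent_source.1 h
  have h_snd : (extChartAt (JJ E) φ₀ ψ).2 =
      ψ.2 ∘L (trivializationAt E (TangentSpace 𝓘(ℝ, E)) φ₀.1).symmL ℝ ψ.1 := by
    rw [FiberBundle.extChartAt]
    simp [hom_trivializationAt_apply, ContinuousLinearMap.inCoordinates]
  rw [h_snd, TangentBundle.symmL_trivializationAt h_base, (𝓘(ℝ, E)).range_eq_univ,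
    mfderivWithin_univ]
  rfl

lemma extChartAt_cotangent_symm_fst (hy : y ∈ (extChartAt (JJ E) φ₀).target) :
    extChartAt 𝓘(ℝ, E) φ₀.1 ((extChartAt (JJ E) φ₀).symm y).1 = y.1 := by
  rw [← extChartAt_cotangent_fst, (extChartAt (JJ E) φ₀).right_inv hy]

lemma dproj_mfderiv_extChartAt_symm (hy : y ∈ (extChartAt (JJ E) φ₀).target)
    (v : E × (E →L[ℝ] ℝ)) :
    dproj ((extChartAt (JJ E) φ₀).symm y)
      (mfderiv 𝓘(ℝ, E × (E →L[ℝ] ℝ)) (JJ E) (extChartAt (JJ E) φ₀).symm y v) =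
    mfderiv 𝓘(ℝ, E) 𝓘(ℝ, E) (extChartAt 𝓘(ℝ, E) φ₀.1).symm y.1 v.1 := by
  have h_source := mem_extChartAt_cotangent_source.1 ((extChartAt (JJ E) φ₀).map_target hy)
  have h_rep : chartRep (JJ E) 𝓘(ℝ, E) (fun ψ : TStar E P => ψ.1) φ₀ φ₀.1 =ᶠ[𝓝 y] Prod.fst :=
    mem_of_superset (extChartAt_target_mem_nhds' hy) fun _ hz => extChartAt_cotangent_symm_fst hz
  have h_fderiv := fderiv_chartRep contMDiff_cotangent_proj hy h_source v
  rw [h_rep.fderiv_eq, fderiv_fst] at h_fderiv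
  have h := mfderiv_extChartAt_symm_mfderiv h_source (dproj ((extChartAt (JJ E) φ₀).symm y)
    (mfderiv 𝓘(ℝ, E × (E →L[ℝ] ℝ)) (JJ E) (extChartAt (JJ E) φ₀).symm y v))
  rw [extChartAt_cotangent_symm_fst hy] at h
  exact h.symm.trans (congrArg (mfderiv 𝓘(ℝ, E) 𝓘(ℝ, E) _ y.1) h_fderiv.symm)

lemma dproj_surjective (φ : TStar E P) : Function.Surjective (dproj φ) := fun w => by
  have h := dproj_mfderiv_extChartAt_symm (mem_extChartAt_target φ)
    (mfderiv 𝓘(ℝ, E) 𝓘(ℝ, E) (extChartAt 𝓘(ℝ, E) φ.1) φ.1 w, 0)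
  rw [extChartAt_to_inv, extChartAt_cotangent_fst] at h
  exact ⟨_, h.trans (mfderiv_extChartAt_symm_mfderiv (E := E) (mem_extChartAt_source φ.1) w)⟩

lemma inChart_canonicalForm (hy : y ∈ (extChartAt (JJ E) φ₀).target) :
    inChart (toForm (canonicalForm E P)) φ₀ y = modelCanonicalForm E y := by
  ext v
  rw [inChart_eq, modelCanonicalForm_apply]
  have h_snd := extChartAt_cotangent_snd_apply ((extChartAt (JJ E) φ₀).map_target hy) (v 0).1
  rw [(extChartAt (JJ E) φ₀).right_inv hy, extChartAt_cotangent_symm_fst hy] at h_snd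
  exact (congrArg ((extChartAt (JJ E) φ₀).symm y).2
    (dproj_mfderiv_extChartAt_symm hy (v 0))).trans h_snd.symm

lemma isSmoothForm_canonicalForm : IsSmoothForm (toForm (canonicalForm E P)) := fun _ =>
  (modelCanonicalForm E).contDiff.contDiffOn.congr fun _ hy => inChart_canonicalForm hy

lemma isNondegenerate_extD_canonicalForm (φ : TStar E P) :
    IsNondegenerate (extD (toForm (canonicalForm E P)) φ) := by
  have : IsManifold (JJ E) 1 (TStar E P) := .of_le (n := ∞) (by simp)
  have h_model : inChart (toForm (canonicalForm E P)) φ =ᶠ[𝓝 (extChartAt (JJ E) φ φ)]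
      modelCanonicalForm E :=
    mem_of_superset (extChartAt_target_mem_nhds φ) fun _ hy => inChart_canonicalForm hy
  rw [extD_eq, h_model.extDeriv_eq]
  exact (isNondegenerate_extDeriv_modelCanonicalForm _).compContinuousLinearMap
    (isInvertible_mfderiv_extChartAt (mem_extChartAt_source φ)).bijective

lemma isSymplectic_extD_canonicalForm : IsSymplectic (extD (toForm (canonicalForm E P))) where
  smooth := isSmoothForm_canonicalForm.extD
  closed := extD_extD isSmoothForm_canonicalForm
  nondegenerate := isNondegenerate_extD_canonicalForm

end CanonicalForm

section BundleMaps

open ContinuousLinearMap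

variable {𝕜 : Type*} [NontriviallyNormedField 𝕜] {n : WithTop ℕ∞}
  {EM : Type*} [NormedAddCommGroup EM] [NormedSpace 𝕜 EM] {HM : Type*} [TopologicalSpace HM]
  {IM : ModelWithCorners 𝕜 EM HM} {M : Type*} [TopologicalSpace M] [ChartedSpace HM M]
  {F₁ F₂ F₃ : Type*} [NormedAddCommGroup F₁] [NormedSpace 𝕜 F₁]
  [NormedAddCommGroup F₂] [NormedSpace 𝕜 F₂] [NormedAddCommGroup F₃] [NormedSpace 𝕜 F₃]

section InCoordinates

variable {B₁ B₂ B₃ : Type*} {E₁ : B₁ → Type*} {E₂ : B₂ → Type*} {E₃ : B₃ → Type*}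
  [TopologicalSpace B₁] [TopologicalSpace B₂] [TopologicalSpace B₃]
  [∀ x, AddCommGroup (E₁ x)] [∀ x, Module 𝕜 (E₁ x)] [∀ x, TopologicalSpace (E₁ x)]
  [∀ x, AddCommGroup (E₂ x)] [∀ x, Module 𝕜 (E₂ x)] [∀ x, TopologicalSpace (E₂ x)]
  [∀ x, AddCommGroup (E₃ x)] [∀ x, Module 𝕜 (E₃ x)] [∀ x, TopologicalSpace (E₃ x)]
  [TopologicalSpace (TotalSpace F₁ E₁)] [TopologicalSpace (TotalSpace F₂ E₂)]
  [TopologicalSpace (TotalSpace F₃ E₃)]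
  [FiberBundle F₁ E₁] [VectorBundle 𝕜 F₁ E₁] [FiberBundle F₂ E₂] [VectorBundle 𝕜 F₂ E₂]
  [FiberBundle F₃ E₃] [VectorBundle 𝕜 F₃ E₃]

lemma inCoordinates_id {x y : B₁} (hy : y ∈ (trivializationAt F₁ E₁ x).baseSet) :
    inCoordinates F₁ E₁ F₁ E₁ x y x y (.id 𝕜 (E₁ y)) = .id 𝕜 F₁ := by
  ext v
  simp [inCoordinates, hy]

lemma inCoordinates_comp {x₁ y₁ : B₁} {x₂ y₂ : B₂} {x₃ y₃ : B₃}
    (hy₂ : y₂ ∈ (trivializationAt F₂ E₂ x₂).baseSet) (ψ : E₂ y₂ →L[𝕜] E₃ y₃)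
    (ϕ : E₁ y₁ →L[𝕜] E₂ y₂) :
    inCoordinates F₁ E₁ F₃ E₃ x₁ y₁ x₃ y₃ (ψ ∘L ϕ) =
      inCoordinates F₂ E₂ F₃ E₃ x₂ y₂ x₃ y₃ ψ ∘L inCoordinates F₁ E₁ F₂ E₂ x₁ y₁ x₂ y₂ ϕ := by
  ext v
  simp [inCoordinates, hy₂]

lemma inCoordinates_trivial_left {x₁ y₁ : B₁} {x₂ y₂ : B₂} (ϕ : F₁ →L[𝕜] E₂ y₂) :
    inCoordinates F₁ (Trivial B₁ F₁) F₂ E₂ x₁ y₁ x₂ y₂ ϕ =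
      (trivializationAt F₂ E₂ x₂).continuousLinearMapAt 𝕜 y₂ ∘L ϕ :=
  congrArg (fun f : F₁ →L[𝕜] F₁ => (trivializationAt F₂ E₂ x₂).continuousLinearMapAt 𝕜 y₂ ∘L ϕ ∘L f)
    (Bundle.Trivial.symmL_trivialization 𝕜 B₁ F₁ y₁)

lemma contMDiffAt_clm_comp_of_inCoordinates {b₁ : M → B₁} {b₂ : M → B₂} {b₃ : M → B₃} {m₀ : M}
    {ψ : ∀ m, E₂ (b₂ m) →L[𝕜] E₃ (b₃ m)} {ϕ : ∀ m, E₁ (b₁ m) →L[𝕜] E₂ (b₂ m)}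
    (hψ : ContMDiffAt IM 𝓘(𝕜, F₂ →L[𝕜] F₃) n
      (fun m => inCoordinates F₂ E₂ F₃ E₃ (b₂ m₀) (b₂ m) (b₃ m₀) (b₃ m) (ψ m)) m₀)
    (hϕ : ContMDiffAt IM 𝓘(𝕜, F₁ →L[𝕜] F₂) n
      (fun m => inCoordinates F₁ E₁ F₂ E₂ (b₁ m₀) (b₁ m) (b₂ m₀) (b₂ m) (ϕ m)) m₀)
    (hb₂ : ContinuousAt b₂ m₀) :
    ContMDiffAt IM 𝓘(𝕜, F₁ →L[𝕜] F₃) n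
      (fun m => inCoordinates F₁ E₁ F₃ E₃ (b₁ m₀) (b₁ m) (b₃ m₀) (b₃ m) (ψ m ∘L ϕ m)) m₀ := by
  refine (hψ.clm_comp hϕ).congr_of_eventuallyEq ?_
  filter_upwards [hb₂ ((trivializationAt F₂ E₂ (b₂ m₀)).open_baseSet.mem_nhds
    (FiberBundle.mem_baseSet_trivializationAt' (b₂ m₀)))] with m hm
  exact inCoordinates_comp hm _ _

end InCoordinates

variable {EB : Type*} [NormedAddCommGroup EB] [NormedSpace 𝕜 EB]
  {HB : Type*} [TopologicalSpace HB] {IB : ModelWithCorners 𝕜 EB HB}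
  {B : Type*} [TopologicalSpace B] [ChartedSpace HB B] {E₁ E₂ E₃ : B → Type*}
  [∀ x, AddCommGroup (E₁ x)] [∀ x, Module 𝕜 (E₁ x)] [∀ x, TopologicalSpace (E₁ x)]
  [TopologicalSpace (TotalSpace F₁ E₁)] [FiberBundle F₁ E₁] [VectorBundle 𝕜 F₁ E₁]

lemma contMDiff_id_section [∀ x, IsTopologicalAddGroup (E₁ x)] [∀ x, ContinuousSMul 𝕜 (E₁ x)] :
    ContMDiff IB (IB.prod 𝓘(𝕜, F₁ →L[𝕜] F₁)) n (fun x => TotalSpace.mk' (F₁ →L[𝕜] F₁)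
      (E := fun x => E₁ x →L[𝕜] E₁ x) x (.id 𝕜 (E₁ x))) := fun x₀ => by
  rw [contMDiffAt_hom_bundle]
  refine ⟨contMDiffAt_id, (contMDiffAt_const (c := .id 𝕜 F₁)).congr_of_eventuallyEq ?_⟩
  filter_upwards [(trivializationAt F₁ E₁ x₀).open_baseSet.mem_nhds
    (FiberBundle.mem_baseSet_trivializationAt' x₀)] with x hx
  exact inCoordinates_id hx

variable [∀ x, AddCommGroup (E₂ x)] [∀ x, Module 𝕜 (E₂ x)] [∀ x, TopologicalSpace (E₂ x)]
  [∀ x, IsTopologicalAddGroup (E₂ x)] [∀ x, ContinuousSMul 𝕜 (E₂ x)]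
  [TopologicalSpace (TotalSpace F₂ E₂)] [FiberBundle F₂ E₂] [VectorBundle 𝕜 F₂ E₂]
  [∀ x, AddCommGroup (E₃ x)] [∀ x, Module 𝕜 (E₃ x)] [∀ x, TopologicalSpace (E₃ x)]
  [∀ x, IsTopologicalAddGroup (E₃ x)] [∀ x, ContinuousSMul 𝕜 (E₃ x)]
  [TopologicalSpace (TotalSpace F₃ E₃)] [FiberBundle F₃ E₃] [VectorBundle 𝕜 F₃ E₃]

lemma contMDiff_clm_bundle_comp {b : M → B} {ψ : ∀ m, E₂ (b m) →L[𝕜] E₃ (b m)}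
    {ϕ : ∀ m, E₁ (b m) →L[𝕜] E₂ (b m)}
    (hψ : ContMDiff IM (IB.prod 𝓘(𝕜, F₂ →L[𝕜] F₃)) n
      (fun m => TotalSpace.mk' (F₂ →L[𝕜] F₃) (E := fun x => E₂ x →L[𝕜] E₃ x) (b m) (ψ m)))
    (hϕ : ContMDiff IM (IB.prod 𝓘(𝕜, F₁ →L[𝕜] F₂)) n
      (fun m => TotalSpace.mk' (F₁ →L[𝕜] F₂) (E := fun x => E₁ x →L[𝕜] E₂ x) (b m) (ϕ m))) :
    ContMDiff IM (IB.prod 𝓘(𝕜, F₁ →L[𝕜] F₃)) n (fun m => TotalSpace.mk' (F₁ →L[𝕜] F₃)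
      (E := fun x => E₁ x →L[𝕜] E₃ x) (b m) (ψ m ∘L ϕ m)) := fun m₀ => by
  have h_ψ := hψ m₀
  have h_ϕ := hϕ m₀
  rw [contMDiffAt_hom_bundle] at h_ψ h_ϕ ⊢
  exact ⟨h_ϕ.1, contMDiffAt_clm_comp_of_inCoordinates h_ψ.2 h_ϕ.2 h_ϕ.1.continuousAt⟩

end BundleMaps

section Theta

variable {E : Type*} [NormedAddCommGroup E] [NormedSpace ℝ E]
  {P : Type*} [TopologicalSpace P] [ChartedSpace E P] {A A' : TangentEndo E P}

lemma dual_dual_of_comp_eq_id (h : ∀ p, A p ∘L A' p = .id ℝ _) (φ : TStar E P) :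
    dual A' (dual A φ) = φ :=
  congrArg (TotalSpace.mk φ.1) <| by
    rw [dual, ContinuousLinearMap.comp_assoc, h, ContinuousLinearMap.comp_id]

variable [IsManifold 𝓘(ℝ, E) ∞ P]

lemma Theta_injective : Function.Injective (Theta : TangentEndo E P → _) := fun A A' h => by
  funext p
  ext v
  refine (SeparatingDual.eq_iff_forall_dual_eq (R := ℝ) (V := E)).2 fun η => ?_
  obtain ⟨u, rfl⟩ := dproj_surjective (⟨p, η⟩ : TStar E P) v
  exact DFunLike.congr_fun (congrFun h ⟨p, η⟩) u

lemma Theta_ne_zero {φ : TStar E P} (hA : Function.Surjective (A φ.1)) (hφ : φ.2 ≠ 0) :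
    Theta A φ ≠ 0 := fun h => hφ <| by
  ext w
  obtain ⟨v, rfl⟩ := (hA.comp (dproj_surjective φ)) w
  exact DFunLike.congr_fun h v

/-- A smooth vector bundle endomorphism of the tangent bundle over the identity, not required to
be invertible. -/
def IsSmoothEndo (A : TangentEndo E P) : Prop :=
  ContMDiff 𝓘(ℝ, E) (𝓘(ℝ, E).prod 𝓘(ℝ, E →L[ℝ] E)) ∞
    (fun p => (⟨p, A p⟩ : TotalSpace (E →L[ℝ] E)
      (fun p : P => TangentSpace 𝓘(ℝ, E) p →L[ℝ] TangentSpace 𝓘(ℝ, E) p)))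

namespace IsSmoothEndo

lemma contMDiff_dual (hA : IsSmoothEndo A) : ContMDiff (JJ E) (JJ E) ∞ (dual A) :=
  contMDiff_clm_bundle_comp (E₁ := (TangentSpace 𝓘(ℝ, E) : P → Type _))
    (E₂ := (TangentSpace 𝓘(ℝ, E) : P → Type _)) (E₃ := Trivial P ℝ)
    (b := fun φ : TStar E P => φ.1) (ψ := fun φ => φ.2) (ϕ := fun φ => A φ.1)
    contMDiff_id (hA.comp contMDiff_cotangent_proj)

lemma isSmoothOneForm_Theta (hA : IsSmoothEndo A) : IsSmoothOneForm (Theta A) := fun φ₀ => by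
  have : IsManifold 𝓘(ℝ, E) 1 P := .of_le (n := ∞) (by simp)
  have : IsManifold (JJ E) 1 (TStar E P) := .of_le (n := ∞) (by simp)
  have h_proj : ContMDiffAt (JJ E) 𝓘(ℝ, E) ∞ (fun φ : TStar E P => φ.1) φ₀ :=
    contMDiff_cotangent_proj.contMDiffAt
  have h_dual := hA.contMDiff_dual φ₀
  rw [contMDiffAt_hom_bundle] at h_dual ⊢
  have h_comp := contMDiffAt_clm_comp_of_inCoordinates
    (E₁ := (TangentSpace (JJ E) : TStar E P → Type _))
    (E₂ := (TangentSpace 𝓘(ℝ, E) : P → Type _)) (E₃ := Trivial P ℝ)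
    (b₁ := id) (b₂ := fun φ : TStar E P => φ.1) (b₃ := fun φ : TStar E P => φ.1)
    (ψ := fun φ => (dual A φ).2) (ϕ := fun φ => dproj φ)
    h_dual.2 (h_proj.mfderiv_const (m := ∞) (by simp)) h_proj.continuousAt
  exact ⟨contMDiffAt_id, h_comp⟩

lemma isLinearFunction_Theta (hA : IsSmoothEndo A) {ξ : (φ : TStar E P) → TangentSpace (JJ E) φ}
    {χ : (p : P) → TangentSpace 𝓘(ℝ, E) p} (hξ : IsLinearVectorField ξ χ) :
    IsLinearFunction fun φ : TStar E P => Theta A φ (ξ φ) := by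
  have h_apply : (fun φ : TStar E P => Theta A φ (ξ φ)) = fun φ => (dual A φ).2 (χ φ.1) :=
    funext fun φ => congrArg (dual A φ).2 (hξ.projects φ)
  rw [h_apply]
  refine ⟨fun φ₀ => ?_, fun p => ⟨fun _ _ => rfl, fun _ _ => rfl⟩⟩
  have h := ContMDiff.clm_bundle_apply (E₂ := Trivial P ℝ) (b := fun φ : TStar E P => φ.1)
    (ϕ := fun φ => (dual A φ).2) hA.contMDiff_dual
    (hξ.smooth_base.comp contMDiff_cotangent_proj)
  exact (contMDiffAt_totalSpace.1 (h φ₀)).2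

lemma pullback_dual_canonicalForm (hA : IsSmoothEndo A) :
    pullback (I := JJ E) (toForm (canonicalForm E P)) (dual A) = toForm (Theta A) := by
  funext φ
  ext v
  have h_proj := (contMDiff_cotangent_proj (E := E) (P := P)).mdifferentiable (by simp) (dual A φ)
  have h_comp := mfderiv_comp (I' := JJ E) φ h_proj (hA.contMDiff_dual.mdifferentiable (by simp) φ)
  exact congrArg (φ.2 ∘L A φ.1) (DFunLike.congr_fun h_comp (v 0)).symm

lemma extD_toForm_Theta (hA : IsSmoothEndo A) :
    extD (toForm (Theta A)) = pullback (extD (toForm (canonicalForm E P))) (dual A) := by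
  rw [← hA.pullback_dual_canonicalForm, extD_pullback isSmoothForm_canonicalForm hA.contMDiff_dual]

/-- The dual bundle map of a smooth automorphism of the tangent bundle, as a diffeomorphism of the
cotangent bundle. -/
def dualDiffeomorph (hA : IsSmoothEndo A) (hA' : IsSmoothEndo A')
    (h : ∀ p, A p ∘L A' p = .id ℝ _) (h' : ∀ p, A' p ∘L A p = .id ℝ _) :
    TStar E P ≃ₘ^∞⟮JJ E, JJ E⟯ TStar E P where
  toFun := dual A
  invFun := dual A'
  left_inv := dual_dual_of_comp_eq_id h
  right_inv := dual_dual_of_comp_eq_id h'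
  contMDiff_toFun := hA.contMDiff_dual
  contMDiff_invFun := hA'.contMDiff_dual

lemma isSymplectic_extD_Theta (hA : IsSmoothEndo A) (hA' : IsSmoothEndo A')
    (h : ∀ p, A p ∘L A' p = .id ℝ _) (h' : ∀ p, A' p ∘L A p = .id ℝ _) :
    IsSymplectic (extD (toForm (Theta A))) := by
  rw [hA.extD_toForm_Theta]
  exact isSymplectic_extD_canonicalForm.pullback_diffeomorph (hA.dualDiffeomorph hA' h h')

end IsSmoothEndo

lemma Theta_mem_Can (hA : IsSmoothEndo A) (hA_surj : ∀ p, Function.Surjective (A p)) :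
    Theta A ∈ Can E P :=
  ⟨hA.isSmoothOneForm_Theta, fun φ hφ => Theta_ne_zero (hA_surj φ.1) hφ,
    fun φ v hv => by simp [Theta, hv], fun _ _ hξ => hA.isLinearFunction_Theta hξ⟩

end Theta

section Principal

variable {EP EM EG : Type*} [NormedAddCommGroup EP] [NormedSpace ℝ EP]
  [NormedAddCommGroup EM] [NormedSpace ℝ EM] [NormedAddCommGroup EG] [NormedSpace ℝ EG]
  {P M G : Type*} [TopologicalSpace P] [ChartedSpace EP P]
  [TopologicalSpace M] [ChartedSpace EM M] [TopologicalSpace G] [ChartedSpace EG G] [Group G]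

namespace PrincipalBundle

variable (Q : PrincipalBundle EP EM EG P M G)

lemma contMDiff_orbit (p : P) : ContMDiff 𝓘(ℝ, EG) 𝓘(ℝ, EP) ∞ (fun g : G => Q.κ p g) :=
  Q.smooth_κ.comp (contMDiff_const.prodMk contMDiff_id)

lemma contMDiff_act (g : G) : ContMDiff 𝓘(ℝ, EP) 𝓘(ℝ, EP) ∞ (fun p : P => Q.κ p g) :=
  Q.smooth_κ.comp (contMDiff_id.prodMk contMDiff_const)

lemma mfderiv_μ_dorbit (p : P) (X : GroupLieAlgebra 𝓘(ℝ, EG) G) :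
    mfderiv 𝓘(ℝ, EP) 𝓘(ℝ, EM) Q.μ p (Q.dorbit p X) = 0 := by
  have h_orbit := (Q.contMDiff_orbit p).mdifferentiable (by simp) 1
  have h_μ := Q.smooth_μ.mdifferentiable (by simp) (Q.κ p 1)
  have h_const : Q.μ ∘ (fun g : G => Q.κ p g) = fun _ => Q.μ p := funext (Q.μ_act p)
  have h := mfderiv_comp (I' := 𝓘(ℝ, EP)) (1 : G) h_μ h_orbit
  rw [h_const, mfderiv_const, Q.act_one] at h
  exact (DFunLike.congr_fun h X).symm

variable [LieGroup 𝓘(ℝ, EG) ∞ G]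

lemma dact_dorbit (p : P) (g : G) (X : GroupLieAlgebra 𝓘(ℝ, EG) G) :
    Q.dact g p (Q.dorbit p X) = Q.dorbit (Q.κ p g) (Ad g⁻¹ X) := by
  have h_conj_smooth : ContMDiff 𝓘(ℝ, EG) 𝓘(ℝ, EG) ∞ (fun h : G => g⁻¹ * h * g⁻¹⁻¹) :=
    (contMDiff_const.mul contMDiff_id).mul contMDiff_const
  have h_conj_one : g⁻¹ * 1 * g⁻¹⁻¹ = 1 := by simp
  have h_comm : (fun q : P => Q.κ q g) ∘ (fun h : G => Q.κ p h) =
      (fun h : G => Q.κ (Q.κ p g) h) ∘ fun h : G => g⁻¹ * h * g⁻¹⁻¹ := by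
    funext h
    simp [← Q.act_mul, mul_assoc]
  have h_left := mfderiv_comp (I' := 𝓘(ℝ, EP)) (1 : G)
    ((Q.contMDiff_act g).mdifferentiable (by simp) (Q.κ p 1))
    ((Q.contMDiff_orbit p).mdifferentiable (by simp) 1)
  have h_right := mfderiv_comp (I' := 𝓘(ℝ, EG)) (1 : G)
    ((Q.contMDiff_orbit (Q.κ p g)).mdifferentiable (by simp) (g⁻¹ * 1 * g⁻¹⁻¹))
    (h_conj_smooth.mdifferentiable (by simp) 1)
  rw [h_comm, h_right, Q.act_one, h_conj_one] at h_left
  exact (DFunLike.congr_fun h_left X).symm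

variable [IsManifold 𝓘(ℝ, EP) ∞ P]

lemma contMDiff_dorbit :
    ContMDiff 𝓘(ℝ, EP) (𝓘(ℝ, EP).prod 𝓘(ℝ, EG →L[ℝ] EP)) ∞
      (fun p => TotalSpace.mk' (EG →L[ℝ] EP)
        (E := fun p : P => Trivial P EG p →L[ℝ] TangentSpace 𝓘(ℝ, EP) p) p (Q.dorbit p)) :=
    fun p₀ => by
  have : IsManifold 𝓘(ℝ, EP) 1 P := .of_le (n := ∞) (by simp)
  have : IsManifold 𝓘(ℝ, EG) ∞ G := inferInstance
  have : IsManifold 𝓘(ℝ, EG) 1 G := .of_le (n := ∞) (by simp)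
  have h_deriv := ContMDiffAt.mfderiv (m := ∞) Q.κ (fun _ : P => (1 : G)) (x₀ := p₀)
    Q.smooth_κ.contMDiffAt contMDiffAt_const (by simp)
  simp only [Q.act_one] at h_deriv
  have h_id : ContMDiffAt 𝓘(ℝ, EP) 𝓘(ℝ, EG →L[ℝ] EG) ∞
      (fun p => ContinuousLinearMap.inCoordinates EG (Trivial P EG) EG
        (TangentSpace 𝓘(ℝ, EG) : G → Type _) p₀ p 1 1 (.id ℝ EG)) p₀ :=
    (contMDiffAt_const (M' := EG →L[ℝ] EG)).congr_of_eventuallyEq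
      (.of_forall fun _ => inCoordinates_trivial_left _)
  rw [contMDiffAt_hom_bundle]
  exact ⟨contMDiffAt_id, contMDiffAt_clm_comp_of_inCoordinates
    (E₁ := Trivial P EG) (E₂ := (TangentSpace 𝓘(ℝ, EG) : G → Type _))
    (E₃ := (TangentSpace 𝓘(ℝ, EP) : P → Type _))
    (b₁ := id) (b₂ := fun _ => (1 : G)) (b₃ := id) (ψ := Q.dorbit) (ϕ := fun _ => .id ℝ EG)
    h_deriv h_id continuousAt_const⟩

end PrincipalBundle

end Principal

section Connection

variable {EP EM EG : Type*} [NormedAddCommGroup EP] [NormedSpace ℝ EP]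
  [NormedAddCommGroup EM] [NormedSpace ℝ EM] [NormedAddCommGroup EG] [NormedSpace ℝ EG]
  {P M G : Type*} [TopologicalSpace P] [ChartedSpace EP P] [IsManifold 𝓘(ℝ, EP) ∞ P]
  [TopologicalSpace M] [ChartedSpace EM M] [TopologicalSpace G] [ChartedSpace EG G] [Group G]

namespace Connection

variable {Q : PrincipalBundle EP EM EG P M G} (α α' : Connection Q)

lemma idAddB_apply (p : P) (v : TangentSpace 𝓘(ℝ, EP) p) :
    α.idAddB α' p v = v + Q.dorbit p (α'.form p v - α.form p v) := rfl

lemma idAddB_dorbit (p : P) (X : GroupLieAlgebra 𝓘(ℝ, EG) G) :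
    α.idAddB α' p (Q.dorbit p X) = Q.dorbit p X := by
  rw [idAddB_apply, form_dorbit, form_dorbit, sub_self, map_zero, add_zero]

lemma idAddB_comp_idAddB (p : P) : α.idAddB α' p ∘L α'.idAddB α p = .id ℝ _ := by
  ext v
  simp only [ContinuousLinearMap.comp_apply, idAddB_apply, map_add, map_sub, form_dorbit]
  rw [ContinuousLinearMap.id_apply]
  abel

lemma idAddB_injective : Function.Injective α.idAddB := fun β β' h => by
  have h_form : β.form = β'.form := by
    funext p
    ext v
    have h_apply := congrArg (α.form p) (DFunLike.congr_fun (congrFun h p) v)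
    simpa [idAddB_apply, form_dorbit] using h_apply
  cases β
  cases β'
  congr

lemma iota_eq_Theta : α.iota α' = Theta (α.idAddB α') := by
  funext φ
  ext v
  exact (map_add φ.2 _ _).symm

lemma iota_injective : Function.Injective α.iota := by
  have h_iota : α.iota = Theta ∘ α.idAddB := funext α.iota_eq_Theta
  rw [h_iota]
  exact Theta_injective.comp α.idAddB_injective

variable [LieGroup 𝓘(ℝ, EG) ∞ G]

lemma idAddB_dact (g : G) (p : P) (v : TangentSpace 𝓘(ℝ, EP) p) :
    α.idAddB α' (Q.κ p g) (Q.dact g p v) = Q.dact g p (α.idAddB α' p v) := by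
  rw [idAddB_apply, idAddB_apply, form_dact, form_dact, ← map_sub, map_add, Q.dact_dorbit]

lemma isSmoothEndo_idAddB : IsSmoothEndo (α.idAddB α') :=
  contMDiff_id_section.add_section <| contMDiff_clm_bundle_comp (E₂ := Trivial P EG)
    (b := id) Q.contMDiff_dorbit (α'.smooth.sub_section α.smooth)

lemma isAut₀_idAddB : IsAut₀ (α.idAddB α') where
  smooth := α.isSmoothEndo_idAddB α'
  bijective p := Function.bijective_iff_has_inverse.2 ⟨α'.idAddB α p,
    DFunLike.congr_fun (α'.idAddB_comp_idAddB α p), DFunLike.congr_fun (α.idAddB_comp_idAddB α' p)⟩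

lemma isAutTG_idAddB : Q.IsAutTG (α.idAddB α') where
  isAut₀ := α.isAut₀_idAddB α'
  commutes g X p v := by
    rw [PrincipalBundle.Phi, idAddB_dact, map_add, idAddB_dorbit, PrincipalBundle.Phi]

lemma isAutN_idAddB : Q.IsAutN (α.idAddB α') where
  isAutTG := α.isAutTG_idAddB α'
  vertical p v := by
    rw [idAddB_apply, add_sub_cancel_left]
    exact Q.mfderiv_μ_dorbit p _

lemma iota_mem_CanTG : α.iota α' ∈ Q.CanTG :=
  ⟨α.idAddB α', α.isAutTG_idAddB α', α.iota_eq_Theta α'⟩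

lemma iota_mem_Can : α.iota α' ∈ Can EP P := by
  rw [iota_eq_Theta]
  exact Theta_mem_Can (α.isSmoothEndo_idAddB α') fun p => ((α.isAut₀_idAddB α').bijective p).2

end Connection

end Connection

end GenCanon

end

theorem corollary7_general
    {EP EM EG : Type*}
    [NormedAddCommGroup EP] [NormedSpace ℝ EP]
    [NormedAddCommGroup EM] [NormedSpace ℝ EM]
    [NormedAddCommGroup EG] [NormedSpace ℝ EG]
    {P M G : Type*}
    [TopologicalSpace P] [ChartedSpace EP P] [IsManifold 𝓘(ℝ, EP) ∞ P]
    [TopologicalSpace M] [ChartedSpace EM M]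
    [TopologicalSpace G] [ChartedSpace EG G] [Group G] [LieGroup 𝓘(ℝ, EG) ∞ G]
    (Q : GenCanon.PrincipalBundle EP EM EG P M G) (α : GenCanon.Connection Q) :
    (∀ α' : GenCanon.Connection Q,
      α.iota α' ∈ GenCanon.Can EP P ∧ α.iota α' ∈ Q.CanTG) ∧
    Function.Injective α.iota ∧
    (∀ α' : GenCanon.Connection Q,
      Q.IsAutN (α.idAddB α') ∧
      ContMDiff (GenCanon.JJ EP) (GenCanon.JJ EP) ∞ (GenCanon.dual (α.idAddB α')) ∧
      GenCanon.IsSymplectic (GenCanon.extD (GenCanon.toForm (α.iota α'))) ∧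
      GenCanon.extD (GenCanon.toForm (α.iota α')) =
        GenCanon.pullback (GenCanon.extD (GenCanon.toForm (GenCanon.canonicalForm EP P)))
          (GenCanon.dual (α.idAddB α'))) := by
  refine ⟨fun α' => ⟨α.iota_mem_Can α', α.iota_mem_CanTG α'⟩, α.iota_injective, fun α' => ?_⟩
  have hA := α.isSmoothEndo_idAddB α'
  rw [α.iota_eq_Theta α']
  exact ⟨α.isAutN_idAddB α', hA.contMDiff_dual,
    hA.isSymplectic_extD_Theta (α'.isSmoothEndo_idAddB α)
      (α.idAddB_comp_idAddB α') (α'.idAddB_comp_idAddB α),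
    hA.extD_toForm_Theta⟩

theorem corollary7
    {EP EM EG : Type*}
    [NormedAddCommGroup EP] [NormedSpace ℝ EP] [FiniteDimensional ℝ EP]
    [NormedAddCommGroup EM] [NormedSpace ℝ EM] [FiniteDimensional ℝ EM]
    [NormedAddCommGroup EG] [NormedSpace ℝ EG] [FiniteDimensional ℝ EG]
    {P M G : Type*}
    [TopologicalSpace P] [ChartedSpace EP P] [IsManifold 𝓘(ℝ, EP) ∞ P]
    [TopologicalSpace M] [ChartedSpace EM M] [IsManifold 𝓘(ℝ, EM) ∞ M]
    [TopologicalSpace G] [ChartedSpace EG G] [Group G] [LieGroup 𝓘(ℝ, EG) ∞ G]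
    (Q : GenCanon.PrincipalBundle EP EM EG P M G) (α : GenCanon.Connection Q) :
    (∀ α' : GenCanon.Connection Q,
      α.iota α' ∈ GenCanon.Can EP P ∧ α.iota α' ∈ Q.CanTG) ∧
    Function.Injective α.iota ∧
    (∀ α' : GenCanon.Connection Q,
      Q.IsAutN (α.idAddB α') ∧
      ContMDiff (GenCanon.JJ EP) (GenCanon.JJ EP) ∞ (GenCanon.dual (α.idAddB α')) ∧
      GenCanon.IsSymplectic (GenCanon.extD (GenCanon.toForm (α.iota α'))) ∧
      GenCanon.extD (GenCanon.toForm (α.iota α')) =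
        GenCanon.pullback (GenCanon.extD (GenCanon.toForm (GenCanon.canonicalForm EP P)))
          (GenCanon.dual (α.idAddB α'))) :=
  corollary7_general Q α
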